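/- Let $E=(E^0,E^1,r,s)$ be an arbitrary directed graph with vertex set $E^0$ (with the discrete topology), edge set $E^1$ and range and source maps $r,s:E^1\to E^0$. Call a vertex $v$ \emph{singular} if $r^{-1}(v)$ is empty or infinite. Let $C^*(E)$ be the universal C*-algebra generated by mutually orthogonal projections $\{p_v\}_{v\in E^0}$ and partial isometries $\{s_e\}_{e\in E^1}$ with mutually orthogonal ranges such that $s_e^*s_e=p_{s(e)}$ and $s_es_e^*\le p_{r(e)}$ for every $e\in E^1$, and $p_v=\sum_{e\in r^{-1}(v)}s_es_e^*$ whenever $0<|r^{-1}(v)|<\infty$. Regard $C_0(E^0)$ as mapped into $C^*(E)$ by $f\mapsto\sum_{v}f(v)p_v$. Let $c:E^1\to(0,\infty)$, and let $\sigma$ be the one-parameter group of automorphisms of $C^*(E)$ with $\sigma_t(p_v)=p_v$ and $\sigma_t(s_e)=c(e)^{it}s_e$ for $t\in\mathbb{R}$. An element $b\in C^*(E)$ is \emph{analytic} if $t\mapsto\sigma_t(b)$ extends to an entire function $\zeta\mapsto\sigma_\zeta(b)$ with values in $C^*(E)$. A state $\phi$ on $C^*(E)$ is a \emph{$\sigma$-ground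 state} if for all analytic $a,b$ the function $\zeta\mapsto\phi(a\,\sigma_\zeta(b))$ is bounded on $\{\zeta\in\mathbb{C}:\operatorname{Im}\zeta\ge 0\}$. \textbf{Theorem.} If $c(e)>1$ for all $e\in E^1$, then $\phi\mapsto\phi|_{C_0(E^0)}$ is a bijection from the set of $\sigma$-ground states on $C^*(E)$ onto the set of tracial states $\tau$ on $C_0(E^0)$ such that $\operatorname{supp}(\tau)\subseteq\{v\in E^0: v \text{ is singular}\}$. -/

import Mathlib

universe u v w

open scoped ENNReal ZeroAtInfty ComplexOrder

noncomputable section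

/-- A directed graph with vertex set `V` and edge set `E` (loops and multiple edges allowed),
given by its range and source maps. -/
structure DirectedGraph (V : Type u) (E : Type v) where
  /-- the range map `r` -/
  range : E → V
  /-- the source map `s` -/
  source : E → V

namespace DirectedGraph

variable {V : Type u} {E : Type v} (G : DirectedGraph V E)

/-- A vertex is singular if it receives no edge or infinitely many edges. -/
def IsSingular (x : V) : Prop :=
  (G.range ⁻¹' {x} = ∅) ∨ (G.range ⁻¹' {x}).Infinite

/-- The defining relations of the graph C⋆-algebra for elements `p x`, `s e` of a (not necessarily
unital) C⋆-algebra. -/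
structure IsCuntzKrieger {A : Type w} [NonUnitalCStarAlgebra A] (p : V → A) (s : E → A) :
    Prop where
  /-- the `p x` are projections -/
  proj : ∀ x, IsStarProjection (p x)
  /-- which are mutually orthogonal -/
  proj_orth : ∀ x y, x ≠ y → p x * p y = 0
  /-- the `s e` are partial isometries -/
  partial_isometry : ∀ e, s e * star (s e) * s e = s e
  /-- with mutually orthogonal ranges -/
  range_orth : ∀ e f, e ≠ f → (s e * star (s e)) * (s f * star (s f)) = 0
  /-- `s_e^* s_e = p_{s(e)}` -/
  star_mul : ∀ e, star (s e) * s e = p (G.source e)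
  /-- `s_e s_e^* ≤ p_{r(e)}`, as an inequality between projections -/
  le_range : ∀ e, p (G.range e) * (s e * star (s e)) = s e * star (s e)
  /-- `p_x = ∑_{r(e) = x} s_e s_e^*` whenever `r⁻¹(x)` is finite and nonempty -/
  sum_eq : ∀ (x : V) (F : Finset E), F.Nonempty → (∀ e, e ∈ F ↔ G.range e = x) →
    p x = ∑ e ∈ F, s e * star (s e)

/-- A realisation of the defining relations in some C⋆-algebra.

A C⋆-algebra generated by elements satisfying the relations has a dense subset indexed by words in
`V`, `E` and complex scalars, so it is isomorphic to one whose underlying type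
lives in `Type (max u v)`. -/
structure Realisation where
  /-- the C⋆-algebra -/
  carrier : Type (max u v)
  [inst : NonUnitalCStarAlgebra carrier]
  /-- the projections -/
  p : V → carrier
  /-- the partial isometries -/
  s : E → carrier
  isCuntzKrieger : G.IsCuntzKrieger p s

attribute [instance] Realisation.inst

variable {G}

lemma IsCuntzKrieger.norm_s_le {A : Type w} [NonUnitalCStarAlgebra A] {p : V → A} {s : E → A}
    (h : G.IsCuntzKrieger p s) (e : E) : ‖s e‖ ≤ 1 := by
  have h1 : ‖s e‖ * ‖s e‖ ≤ 1 := by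
    rw [← CStarRing.norm_star_mul_self, h.star_mul]
    exact (h.proj _).norm_le
  nlinarith [norm_nonneg (s e)]

variable (G)

/-- The C⋆-algebra of all bounded families indexed by the realisations. -/
abbrev BoundedFamilies : Type (max u v + 1) := lp (fun i : Realisation G => i.carrier) ∞

/-- The bounded family of all the realisations of `p x`. -/
def bigP (x : V) : BoundedFamilies G :=
  ⟨fun i => i.p x, memℓp_infty ⟨1, by
    rintro _ ⟨i, rfl⟩
    exact (i.isCuntzKrieger.proj x).norm_le⟩⟩

/-- The bounded family of all the realisations of `s e`. -/
def bigS (e : E) : BoundedFamilies G :=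
  ⟨fun i => i.s e, memℓp_infty ⟨1, by
    rintro _ ⟨i, rfl⟩
    exact i.isCuntzKrieger.norm_s_le e⟩⟩

/-- The closed `⋆`-subalgebra generated by the `bigP x` and the `bigS e`. -/
def bigSubalgebra : NonUnitalStarSubalgebra ℂ (BoundedFamilies G) :=
  (NonUnitalStarAlgebra.adjoin ℂ
    (Set.range (bigP G) ∪ Set.range (bigS G))).topologicalClosure

instance isClosed_bigSubalgebra : IsClosed (bigSubalgebra G : Set (BoundedFamilies G)) :=
  NonUnitalStarSubalgebra.isClosed_topologicalClosure _

/-- The C⋆-algebra `C⋆(G)` of the graph: the universal C⋆-algebra generated by elements satisfying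
the relations `IsCuntzKrieger`. The norm of a `⋆`-polynomial in the generators is the supremum of
its norms over all realisations of the relations. -/
def CStar : Type (max u v + 1) := bigSubalgebra G

instance : NonUnitalCStarAlgebra (CStar G) :=
  inferInstanceAs (NonUnitalCStarAlgebra (bigSubalgebra G))

lemma bigP_mem (x : V) : bigP G x ∈ bigSubalgebra G :=
  NonUnitalStarSubalgebra.le_topologicalClosure _
    (NonUnitalStarAlgebra.subset_adjoin ℂ _ (Or.inl ⟨x, rfl⟩))

lemma bigS_mem (e : E) : bigS G e ∈ bigSubalgebra G :=
  NonUnitalStarSubalgebra.le_topologicalClosure _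
    (NonUnitalStarAlgebra.subset_adjoin ℂ _ (Or.inr ⟨e, rfl⟩))

/-- The generating projection `p_x` of `C⋆(G)`. -/
def p (x : V) : CStar G := (⟨bigP G x, bigP_mem G x⟩ : bigSubalgebra G)

/-- The generating partial isometry `s_e` of `C⋆(G)`. -/
def s (e : E) : CStar G := (⟨bigS G e, bigS_mem G e⟩ : bigSubalgebra G)

/-- The inclusion of `C⋆(G)` into the algebra of bounded families. -/
def incl : CStar G →⋆ₙₐ[ℂ] BoundedFamilies G :=
  NonUnitalStarSubalgebraClass.subtype (bigSubalgebra G)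

/-- The evaluation of bounded families at a realisation. -/
def evalAt (i : Realisation G) : BoundedFamilies G →⋆ₙₐ[ℂ] i.carrier where
  toFun x := x i
  map_smul' _ _ := rfl
  map_zero' := rfl
  map_add' _ _ := rfl
  map_mul' _ _ := rfl
  map_star' _ := rfl

/-- The canonical `⋆`-homomorphism from `C⋆(G)` to a realisation of the relations. -/
def lift (i : Realisation G) : CStar G →⋆ₙₐ[ℂ] i.carrier := (evalAt G i).comp (incl G)

@[simp] lemma lift_p (i : Realisation G) (x : V) : lift G i (G.p x) = i.p x := rfl

@[simp] lemma lift_s (i : Realisation G) (e : E) : lift G i (G.s e) = i.s e := rfl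

lemma lift_injective {a b : CStar G} (h : ∀ i, lift G i a = lift G i b) : a = b := by
  apply Subtype.ext
  apply lp.ext
  funext i
  exact h i

/-- The generators of `C⋆(G)` satisfy the defining relations. -/
theorem isCuntzKrieger_p_s : G.IsCuntzKrieger G.p G.s where
  proj x := by
    rw [isStarProjection_iff']
    refine ⟨lift_injective G fun i => ?_, lift_injective G fun i => ?_⟩
    · rw [map_mul, lift_p]; exact (i.isCuntzKrieger.proj x).isIdempotentElem
    · rw [map_star, lift_p]; exact (i.isCuntzKrieger.proj x).isSelfAdjoint
  proj_orth x y h := lift_injective G fun i => by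
    simpa using i.isCuntzKrieger.proj_orth x y h
  partial_isometry e := lift_injective G fun i => by
    simpa [map_star] using i.isCuntzKrieger.partial_isometry e
  range_orth e f h := lift_injective G fun i => by
    simpa [map_star] using i.isCuntzKrieger.range_orth e f h
  star_mul e := lift_injective G fun i => by
    simpa [map_star] using i.isCuntzKrieger.star_mul e
  le_range e := lift_injective G fun i => by
    simpa [map_star] using i.isCuntzKrieger.le_range e
  sum_eq x F hF h := lift_injective G fun i => by
    simpa [map_star, map_sum] using i.isCuntzKrieger.sum_eq x F hF h

variable {G}

/-- `C⋆(G)` is generated, as a C⋆-algebra, by the `p x` and the `s e`. -/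
theorem eq_top_of_isClosed (T : NonUnitalStarSubalgebra ℂ (CStar G))
    (hT : IsClosed (T : Set (CStar G))) (hp : ∀ x, G.p x ∈ T) (hs : ∀ e, G.s e ∈ T) : T = ⊤ := by
  have hemb : Topology.IsClosedEmbedding (incl G) :=
    (isClosed_bigSubalgebra G).isClosedEmbedding_subtypeVal
  have hcl : IsClosed ((T.map (incl G) : NonUnitalStarSubalgebra ℂ (BoundedFamilies G)) :
      Set (BoundedFamilies G)) := by
    rw [NonUnitalStarSubalgebra.coe_map]
    exact hemb.isClosedMap _ hT
  have hle : bigSubalgebra G ≤ T.map (incl G) := by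
    refine NonUnitalStarSubalgebra.topologicalClosure_minimal _ ?_ hcl
    refine NonUnitalStarAlgebra.adjoin_le ?_
    rintro _ (⟨x, rfl⟩ | ⟨e, rfl⟩)
    · exact ⟨G.p x, hp x, rfl⟩
    · exact ⟨G.s e, hs e, rfl⟩
  refine eq_top_iff.2 fun a _ => ?_
  obtain ⟨b, hb, hab⟩ := hle (Subtype.property (p := (· ∈ bigSubalgebra G)) a)
  have : b = a := hemb.injective hab
  exact this ▸ hb

lemma continuous_hom {A B : Type*} [NonUnitalCStarAlgebra A] [NonUnitalCStarAlgebra B]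
    (f : A →⋆ₙₐ[ℂ] B) : Continuous f :=
  AddMonoidHomClass.continuous_of_bound f 1 fun a => by
    simpa using NonUnitalStarAlgHom.norm_apply_le f a

/-- `⋆`-homomorphisms on `C⋆(G)` are determined by their values on the generators; together with
`lift` this is the universal property of `C⋆(G)`. -/
theorem hom_ext {B : Type w} [NonUnitalCStarAlgebra B] {f g : CStar G →⋆ₙₐ[ℂ] B}
    (hp : ∀ x, f (G.p x) = g (G.p x)) (hs : ∀ e, f (G.s e) = g (G.s e)) : f = g := by
  have h := eq_top_of_isClosed (NonUnitalStarAlgHom.equalizer f g)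
    (isClosed_eq (continuous_hom f) (continuous_hom g)) hp hs
  ext a
  have : a ∈ NonUnitalStarAlgHom.equalizer f g := by rw [h]; trivial
  exact this

/-! ### The generalized gauge action -/

lemma IsCuntzKrieger.twist {A : Type w} [NonUnitalCStarAlgebra A] {p : V → A} {s : E → A}
    (h : G.IsCuntzKrieger p s) (z : E → Circle) :
    G.IsCuntzKrieger p (fun e => (z e : ℂ) • s e) := by
  have hz : ∀ e, (z e : ℂ) * star (z e : ℂ) = 1 := fun e => by
    rw [Complex.star_def, Complex.mul_conj, Circle.normSq_coe, Complex.ofReal_one]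
  have hz' : ∀ e, star (z e : ℂ) * (z e : ℂ) = 1 := fun e => by rw [mul_comm, hz]
  have h1 : ∀ e, (z e : ℂ) • s e * star ((z e : ℂ) • s e) = s e * star (s e) := fun e => by
    rw [star_smul, smul_mul_smul_comm, hz, one_smul]
  refine ⟨h.proj, h.proj_orth, fun e => ?_, fun e f hef => ?_, fun e => ?_, fun e => ?_,
    fun x F hF hx => ?_⟩
  · simp only [h1]
    rw [mul_smul_comm, h.partial_isometry]
  · simp only [h1]
    exact h.range_orth e f hef
  · rw [star_smul, smul_mul_smul_comm, hz', one_smul, h.star_mul]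
  · simp only [h1]
    exact h.le_range e
  · simp only [h1]
    exact h.sum_eq x F hF hx

/-- Multiply the partial isometries of a realisation by complex numbers of modulus one. -/
def Realisation.twist (z : E → Circle) (i : Realisation G) : Realisation G where
  carrier := i.carrier
  p := i.p
  s e := (z e : ℂ) • i.s e
  isCuntzKrieger := i.isCuntzKrieger.twist z

variable (G) in
/-- The `⋆`-endomorphism of the algebra of bounded families that sends `x` to the family whose
value at the realisation `i` is that of `x` at the twisted realisation. -/
def bigGauge (z : E → Circle) : BoundedFamilies G →⋆ₙₐ[ℂ] BoundedFamilies G where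
  toFun x := ⟨fun i => (x (i.twist z) : i.carrier), memℓp_infty ⟨‖x‖, by
    rintro _ ⟨i, rfl⟩
    exact lp.norm_apply_le_norm ENNReal.top_ne_zero x (i.twist z)⟩⟩
  map_smul' _ _ := rfl
  map_zero' := rfl
  map_add' _ _ := rfl
  map_mul' _ _ := rfl
  map_star' _ := rfl

lemma bigGauge_mem (z : E → Circle) (a : CStar G) :
    bigGauge G z (incl G a) ∈ bigSubalgebra G := by
  have h := eq_top_of_isClosed
    ((bigSubalgebra G).comap ((bigGauge G z).comp (incl G)))
    ((isClosed_bigSubalgebra G).preimage (continuous_hom ((bigGauge G z).comp (incl G))))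
    (fun x => bigP_mem G x)
    (fun e => (SMulMemClass.smul_mem (z e : ℂ) (bigS_mem G e) :
      (z e : ℂ) • bigS G e ∈ bigSubalgebra G))
  have : a ∈ (bigSubalgebra G).comap ((bigGauge G z).comp (incl G)) := by rw [h]; trivial
  exact this

variable (G) in
/-- The `⋆`-endomorphism of `C⋆(G)` with `p x ↦ p x` and `s e ↦ z e • s e`. -/
def gauge (z : E → Circle) : CStar G →⋆ₙₐ[ℂ] CStar G :=
  NonUnitalStarAlgHom.codRestrict ((bigGauge G z).comp (incl G)) (bigSubalgebra G)
    (bigGauge_mem z)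

@[simp] lemma gauge_p (z : E → Circle) (x : V) : gauge G z (G.p x) = G.p x := rfl

@[simp] lemma gauge_s (z : E → Circle) (e : E) : gauge G z (G.s e) = (z e : ℂ) • G.s e := rfl

variable (G) in
/-- The one-parameter group `σ` on `C⋆(G)` given by `c : E → (0, ∞)`: it fixes every `p x` and maps
`s e` to `c(e)^{it} s e`; here `c(e)^{it} = exp(i t log c(e))`. -/
def action (c : E → Set.Ioi (0 : ℝ)) (t : ℝ) : CStar G →⋆ₙₐ[ℂ] CStar G :=
  gauge G fun e => Circle.exp (t * Real.log (c e))

lemma action_p (c : E → Set.Ioi (0 : ℝ)) (t : ℝ) (x : V) : action G c t (G.p x) = G.p x := rfl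

lemma action_s (c : E → Set.Ioi (0 : ℝ)) (t : ℝ) (e : E) :
    action G c t (G.s e) = (((c e : ℝ) : ℂ) ^ (Complex.I * t)) • G.s e := by
  have hc : (0 : ℝ) < c e := (c e).2
  rw [action, gauge_s, Circle.coe_exp,
    Complex.cpow_def_of_ne_zero (Complex.ofReal_ne_zero.2 hc.ne'), ← Complex.ofReal_log hc.le]
  push_cast
  congr 2
  ring

lemma action_zero (c : E → Set.Ioi (0 : ℝ)) :
    action G c 0 = NonUnitalStarAlgHom.id ℂ (CStar G) := by
  refine hom_ext (fun x => rfl) fun e => ?_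
  rw [action_s]
  simp

lemma action_add (c : E → Set.Ioi (0 : ℝ)) (t u : ℝ) :
    action G c (t + u) = (action G c t).comp (action G c u) := by
  refine hom_ext (fun x => rfl) fun e => ?_
  have hc : (((c e : ℝ)) : ℂ) ≠ 0 := Complex.ofReal_ne_zero.2 (ne_of_gt (c e).2)
  rw [NonUnitalStarAlgHom.comp_apply, action_s, action_s, map_smul, action_s, smul_smul,
    ← Complex.cpow_add _ _ hc]
  push_cast
  congr 2
  ring

/-! ### The copy of `C₀(V)` in `C⋆(G)` -/

section vertexAlgebra

/-- For a finite set `F` of vertices, the `⋆`-homomorphism `a ↦ ∑ x ∈ F, a x • p x`. -/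
def finsetHom (G : DirectedGraph V E) (F : Finset V) : (F → ℂ) →⋆ₙₐ[ℂ] CStar G where
  toFun a := ∑ x, a x • G.p x
  map_smul' r a := by simp [Finset.smul_sum, smul_smul]
  map_zero' := by simp
  map_add' a b := by simp [add_smul, Finset.sum_add_distrib]
  map_mul' a b := by
    rw [Finset.sum_mul_sum]
    refine Finset.sum_congr rfl fun x _ => ?_
    rw [Finset.sum_eq_single x]
    · rw [smul_mul_smul_comm, (G.isCuntzKrieger_p_s.proj x).isIdempotentElem, Pi.mul_apply]
    · intro y _ hy
      rw [smul_mul_smul_comm, G.isCuntzKrieger_p_s.proj_orth x y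
        (fun h => hy (Subtype.ext h.symm)), smul_zero]
    · simp
  map_star' a := by
    rw [star_sum]
    refine Finset.sum_congr rfl fun x _ => ?_
    rw [star_smul, (G.isCuntzKrieger_p_s.proj x).isSelfAdjoint, Pi.star_apply]

lemma norm_sum_smul_p_le (F : Finset V) (a : V → ℂ) {M : ℝ} (hM : 0 ≤ M)
    (h : ∀ x ∈ F, ‖a x‖ ≤ M) : ‖∑ x ∈ F, a x • G.p x‖ ≤ M := by
  have h1 : ∑ x ∈ F, a x • G.p x = finsetHom G F fun x => a x :=
    (Finset.sum_coe_sort F fun x => a x • G.p x).symm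
  rw [h1]
  refine (NonUnitalStarAlgHom.norm_apply_le (finsetHom G F) _).trans ?_
  exact (pi_norm_le_iff_of_nonneg hM).2 fun x => h x x.2

variable [TopologicalSpace V] [DiscreteTopology V]

lemma summable_smul_p (f : C₀(V, ℂ)) : Summable fun x => f x • G.p x := by
  rw [summable_iff_vanishing_norm]
  intro ε hε
  have h := (zero_at_infty f).eventually (Metric.ball_mem_nhds 0 (half_pos hε))
  rw [Filter.cocompact_eq_cofinite, Filter.eventually_cofinite] at h
  refine ⟨h.toFinset, fun F hF => ?_⟩
  refine (norm_sum_smul_p_le F f (half_pos hε).le fun x hx => ?_).trans_lt (half_lt_self hε)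
  by_contra hlt
  refine Finset.disjoint_left.1 hF hx (h.mem_toFinset.2 fun hb => hlt ?_)
  exact (mem_ball_zero_iff.1 hb).le

lemma tsum_mul_p (f : C₀(V, ℂ)) (x : V) : (∑' y, f y • G.p y) * G.p x = f x • G.p x := by
  rw [← (summable_smul_p (G := G) f).tsum_mul_right, tsum_eq_single x]
  · rw [smul_mul_assoc, (G.isCuntzKrieger_p_s.proj x).isIdempotentElem]
  · intro y hy
    rw [smul_mul_assoc, G.isCuntzKrieger_p_s.proj_orth y x hy, smul_zero]

variable (G) in
/-- The canonical `⋆`-homomorphism `C₀(V) → C⋆(G)`, `f ↦ ∑ x, f x • p x`, for the discrete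
topology on `V`; it sends the characteristic function of `{x}` to `p x`. -/
def vertexHom : C₀(V, ℂ) →⋆ₙₐ[ℂ] CStar G where
  toFun f := ∑' x, f x • G.p x
  map_smul' r f := by
    simp only [ZeroAtInftyContinuousMap.smul_apply, smul_assoc, MonoidHom.id_apply]
    exact (summable_smul_p f).tsum_const_smul r
  map_zero' := by simp
  map_add' f g := by
    simp only [ZeroAtInftyContinuousMap.add_apply, add_smul]
    exact (summable_smul_p f).tsum_add (summable_smul_p g)
  map_mul' f g := by
    rw [← (summable_smul_p (G := G) g).tsum_mul_left]
    refine tsum_congr fun x => ?_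
    rw [mul_smul_comm, tsum_mul_p, smul_smul, ZeroAtInftyContinuousMap.mul_apply, mul_comm]
  map_star' f := by
    rw [tsum_star]
    refine tsum_congr fun x => ?_
    rw [star_smul, (G.isCuntzKrieger_p_s.proj x).isSelfAdjoint, ZeroAtInftyContinuousMap.star_apply]

/-- The canonical homomorphism `C₀(V) → C⋆(G)` as a continuous linear map. -/
def vertexCLM (G : DirectedGraph V E) : C₀(V, ℂ) →L[ℂ] CStar G where
  toFun := vertexHom G
  map_add' := map_add (vertexHom G)
  map_smul' := map_smul (vertexHom G)
  cont := continuous_hom (vertexHom G)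

end vertexAlgebra

end DirectedGraph

/-! ### States -/

/-- A state on a C⋆-algebra: a positive linear functional of norm one. -/
structure IsState {A : Type w} [NonUnitalCStarAlgebra A] (φ : A →L[ℂ] ℂ) : Prop where
  nonneg : ∀ a, 0 ≤ φ (star a * a)
  norm_eq_one : ‖φ‖ = 1

/-- A tracial state on a C⋆-algebra. -/
structure IsTracialState {A : Type w} [NonUnitalCStarAlgebra A] (τ : A →L[ℂ] ℂ) : Prop
    extends IsState τ where
  mul_comm : ∀ a b, τ (a * b) = τ (b * a)

/-- The support of a functional on `C₀(X)`: a point `x` belongs to it if and only if on every open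
neighbourhood of `x` there lives a function on which the functional does not vanish. -/
def functionalSupport {X : Type w} [TopologicalSpace X] (τ : C₀(X, ℂ) →L[ℂ] ℂ) : Set X :=
  {x | ∀ U : Set X, IsOpen U → x ∈ U → ∃ f : C₀(X, ℂ), Function.support f ⊆ U ∧ τ f ≠ 0}

/-- `f` is the entire extension `ζ ↦ σ_ζ(a)` of the orbit `t ↦ σ_t(a)`. -/
structure IsEntireOrbit {A : Type w} [NonUnitalCStarAlgebra A] (σ : ℝ → A →⋆ₙₐ[ℂ] A) (a : A)
    (f : ℂ → A) : Prop where
  differentiable : Differentiable ℂ f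
  eq_orbit : ∀ t : ℝ, f t = σ t a

/-- The analytic elements: those whose orbit extends to an entire function. -/
def analyticElements {A : Type w} [NonUnitalCStarAlgebra A] (σ : ℝ → A →⋆ₙₐ[ℂ] A) : Set A :=
  {a | ∃ f, IsEntireOrbit σ a f}

/-- `φ` is a `σ`-ground state: a state such that for all analytic `a`, `b` the entire function
`ζ ↦ φ(a σ_ζ(b))` is bounded on the closed upper half plane. -/
structure IsGroundState {A : Type w} [NonUnitalCStarAlgebra A] (σ : ℝ → A →⋆ₙₐ[ℂ] A)
    (φ : A →L[ℂ] ℂ) : Prop extends IsState φ where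
  bounded : ∀ a ∈ analyticElements σ, ∀ b : A, ∀ f : ℂ → A, IsEntireOrbit σ b f →
    ∃ M : ℝ, ∀ ζ : ℂ, 0 ≤ ζ.im → ‖φ (a * f ζ)‖ ≤ M

end

noncomputable section

/-! ### The Cauchy–Schwarz inequality for positive functionals -/

section Positive

variable {A : Type w} [NonUnitalCStarAlgebra A] {φ : A →L[ℂ] ℂ}

/-! Uniqueness. For a ground state `φ`, the function `φ(s_e σ_ζ(s_e^*)) = c(e)^{-iζ} φ(s_e s_e^*)`
grows exponentially up the imaginary axis because `c(e) > 1`. Boundedness therefore forces `φ(s_e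
s_e^*) = 0` (`IsGroundState.apply_s_mul_star_s`). By Cauchy–Schwarz, `φ` kills every `s_e b` and `b
s_e^*`. The products `s_μ s_ν^*` of paths span a dense subspace (`closure_pathSpan_eq_univ`), so `φ`
is determined by its values on the `p_x`. The sum relation makes `φ(p_x)` vanish at a nonsingular
`x`. The restriction still has norm one since finite sums of the `p_x` form an approximate unit, and
traciality is automatic because `C₀(V)` is commutative.

Existence. The relations are represented on `ℓ²` by creation operators on the finite paths that
start at a singular vertex (`isCuntzKrieger_path`). Given `τ`, let `ξ` have coordinate `√τ({x})` at
the path of length zero at `x`. For every `b`, the coordinate of `σ_ζ(b) ξ` at a path of weight `w`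
is `exp(iζw)` times that of `b ξ`. As `w ≥ 0`, this factor has modulus at most one when `Im ζ ≥ 0`,
so `‖σ_ζ(b) ξ‖ ≤ ‖b ξ‖` there (`IsVertexVector.norm_entireOrbit_le`). Hence the vector functional of
`ξ` is a ground state, and the support condition makes it restrict to `τ`. -/

lemma star_map_star_mul_of_nonneg (hφ : ∀ a, 0 ≤ φ (star a * a)) (a b : A) :
    star (φ (star b * a)) = φ (star a * b) := by
  have him : ∀ c, (φ (star c * c)).im = 0 := fun c => (Complex.nonneg_iff.1 (hφ c)).2.symm
  -- Polarisation: `a + b` relates the imaginary parts of the two values, `a + i b` their real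
  -- parts.
  have h1 := him (a + b)
  have h2 := him (a + Complex.I • b)
  simp only [star_add, star_smul, add_mul, mul_add, map_add, smul_mul_assoc, mul_smul_comm,
    map_smul, smul_eq_mul, Complex.add_im, Complex.star_def, Complex.conj_I, him,
    Complex.mul_im, Complex.mul_re, Complex.I_re, Complex.I_im, Complex.neg_re, Complex.neg_im]
    at h1 h2
  apply Complex.ext
  · simp only [Complex.star_def, Complex.conj_re]; linarith
  · simp only [Complex.star_def, Complex.conj_im]; linarith

/-- The Cauchy–Schwarz inequality for a positive functional on a C⋆-algebra. -/
lemma norm_map_star_mul_sq_le (hφ : ∀ a, 0 ≤ φ (star a * a)) (a b : A) :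
    ‖φ (star a * b)‖ ^ 2 ≤ (φ (star a * a)).re * (φ (star b * b)).re := by
  let core : PreInnerProductSpace.Core ℂ A :=
    { inner := fun a b => φ (star a * b)
      conj_inner_symm := star_map_star_mul_of_nonneg hφ
      re_inner_nonneg := fun a => (Complex.nonneg_iff.1 (hφ a)).1
      add_left := fun a b c => by simp [add_mul]
      smul_left := fun a b r => by simp [smul_mul_assoc] }
  have h := InnerProductSpace.Core.inner_mul_inner_self_le (𝕜 := ℂ) a b
  have h1 : ‖φ (star b * a)‖ = ‖φ (star a * b)‖ := by
    rw [← star_map_star_mul_of_nonneg hφ a b, norm_star]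
  calc ‖φ (star a * b)‖ ^ 2 = ‖φ (star a * b)‖ * ‖φ (star b * a)‖ := by rw [h1, sq]
    _ ≤ _ := h

/-- By Cauchy–Schwarz a null vector of the form lies in its radical. This spreads the vanishing on
`s_e s_e^*` to all products beginning with `s_e` or ending with `s_e^*`. -/
lemma map_star_mul_eq_zero_left (hφ : ∀ a, 0 ≤ φ (star a * a)) {a : A}
    (ha : φ (star a * a) = 0) (b : A) : φ (star a * b) = 0 := by
  have h := norm_map_star_mul_sq_le hφ a b
  rw [ha, Complex.zero_re, zero_mul] at h
  exact norm_eq_zero.1 (pow_eq_zero_iff two_ne_zero |>.1 (le_antisymm h (sq_nonneg _)))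

lemma map_star_mul_eq_zero_right (hφ : ∀ a, 0 ≤ φ (star a * a)) {b : A}
    (hb : φ (star b * b) = 0) (a : A) : φ (star a * b) = 0 := by
  rw [← star_map_star_mul_of_nonneg hφ, map_star_mul_eq_zero_left hφ hb, star_zero]

end Positive

namespace DirectedGraph

/-! ### A dense subspace of the graph algebra -/

section Dense

variable {V : Type u} {E : Type v} {G : DirectedGraph V E}

namespace IsCuntzKrieger

variable {A : Type w} [NonUnitalCStarAlgebra A] {p : V → A} {s : E → A}
  (h : G.IsCuntzKrieger p s)


lemma p_range_mul_s (h : G.IsCuntzKrieger p s) (e : E) : p (G.range e) * s e = s e := by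
  nth_rw 1 [← h.partial_isometry e]
  rw [← mul_assoc, h.le_range, h.partial_isometry]

lemma s_mul_p_source (h : G.IsCuntzKrieger p s) (e : E) : s e * p (G.source e) = s e := by
  rw [← h.star_mul, ← mul_assoc, h.partial_isometry]

lemma p_mul_p (h : G.IsCuntzKrieger p s) (x : V) : p x * p x = p x := (h.proj x).isIdempotentElem

lemma star_p (h : G.IsCuntzKrieger p s) (x : V) : star (p x) = p x := (h.proj x).isSelfAdjoint

/-- This dichotomy, and those for `pathElem` below, spare any test of composability: an edge list
that is not a path just gives a zero product, which is harmless in a linear span. -/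
lemma p_mul_s (h : G.IsCuntzKrieger p s) (x : V) (e : E) : p x * s e = 0 ∨ p x * s e = s e := by
  by_cases hx : x = G.range e
  · exact Or.inr (hx ▸ h.p_range_mul_s e)
  · left
    rw [← h.p_range_mul_s e, ← mul_assoc, h.proj_orth x _ hx, zero_mul]

lemma star_s_mul_s_of_ne (h : G.IsCuntzKrieger p s) {e f : E} (hef : e ≠ f) : star (s e) * s f = 0 := by
  have h1 : star (s e) = star (s e) * (s e * star (s e)) := by
    conv_lhs => rw [← h.partial_isometry e]
    simp [mul_assoc]
  rw [h1, ← h.partial_isometry f, mul_assoc, ← mul_assoc (s e * star (s e)),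
    h.range_orth e f hef, zero_mul, mul_zero]

end IsCuntzKrieger

variable (G) in
/-- The product `s_{e₁} ⋯ s_{eₙ} p_x`. -/
def pathElem : List E → V → CStar G
  | [], x => G.p x
  | e :: l, x => G.s e * pathElem l x

lemma pathElem_mul_p (l : List E) (x : V) : pathElem G l x * G.p x = pathElem G l x := by
  induction l with
  | nil => exact G.isCuntzKrieger_p_s.p_mul_p x
  | cons e l ih => rw [pathElem, mul_assoc, ih]

lemma p_mul_pathElem (y : V) (l : List E) (x : V) :
    G.p y * pathElem G l x = 0 ∨ G.p y * pathElem G l x = pathElem G l x := by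
  cases l with
  | nil =>
    by_cases hy : y = x
    · exact Or.inr (hy ▸ G.isCuntzKrieger_p_s.p_mul_p x)
    · exact Or.inl (G.isCuntzKrieger_p_s.proj_orth y x hy)
  | cons e l =>
    rw [pathElem, ← mul_assoc]
    rcases G.isCuntzKrieger_p_s.p_mul_s y e with h | h <;> simp [h]

lemma exists_p_mul_pathElem (l : List E) (x : V) :
    ∃ y, G.p y * pathElem G l x = pathElem G l x := by
  cases l with
  | nil => exact ⟨x, G.isCuntzKrieger_p_s.p_mul_p x⟩
  | cons e l => exact ⟨G.range e, by rw [pathElem, ← mul_assoc, G.isCuntzKrieger_p_s.p_range_mul_s]⟩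

lemma pathElem_mul_s (l : List E) (x : V) (e : E) :
    pathElem G l x * G.s e = 0 ∨ pathElem G l x * G.s e = pathElem G (l ++ [e]) (G.source e) := by
  induction l with
  | nil =>
    rcases G.isCuntzKrieger_p_s.p_mul_s x e with h | h
    · exact Or.inl h
    · right
      simp only [pathElem, List.nil_append]
      rw [h, G.isCuntzKrieger_p_s.s_mul_p_source]
  | cons f l ih =>
    simp only [pathElem, List.cons_append, mul_assoc]
    rcases ih with h | h <;> simp [h]

variable (G) in
/-- The elements `s_μ s_ν^*` (and possibly zero), for finite paths `μ` and `ν`. -/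
def pathProducts : Set (CStar G) :=
  {a | ∃ l x m y, a = pathElem G l x * star (pathElem G m y)}

variable (G) in
/-- The linear span of the `s_μ s_ν^*`. -/
def pathSpan : Submodule ℂ (CStar G) := Submodule.span ℂ (pathProducts G)

lemma pathElem_mul_star_mem (l : List E) (x : V) (m : List E) (y : V) :
    pathElem G l x * star (pathElem G m y) ∈ pathSpan G :=
  Submodule.subset_span ⟨l, x, m, y, rfl⟩

lemma star_pathElem_mem (m : List E) (y : V) : star (pathElem G m y) ∈ pathSpan G := by
  have h := pathElem_mul_star_mem (G := G) [] y m y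
  rwa [pathElem, ← G.isCuntzKrieger_p_s.star_p, ← star_mul, pathElem_mul_p] at h

lemma star_mem_pathSpan {a : CStar G} (ha : a ∈ pathSpan G) : star a ∈ pathSpan G := by
  induction ha using Submodule.span_induction with
  | mem a ha =>
    obtain ⟨l, x, m, y, rfl⟩ := ha
    rw [star_mul, star_star]
    exact pathElem_mul_star_mem m y l x
  | zero => simp
  | add a b _ _ ha hb => rw [star_add]; exact add_mem ha hb
  | smul r a _ ha => rw [star_smul]; exact Submodule.smul_mem _ _ ha

lemma p_mul_mem_pathSpan (z : V) (l : List E) (x : V) (m : List E) (y : V) :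
    G.p z * (pathElem G l x * star (pathElem G m y)) ∈ pathSpan G := by
  rw [← mul_assoc]
  rcases p_mul_pathElem (G := G) z l x with h | h
  · simp [h]
  · rw [h]; exact pathElem_mul_star_mem l x m y

lemma s_mul_mem_pathSpan (e : E) (l : List E) (x : V) (m : List E) (y : V) :
    G.s e * (pathElem G l x * star (pathElem G m y)) ∈ pathSpan G := by
  rw [← mul_assoc]
  exact pathElem_mul_star_mem (e :: l) x m y

/-- The one case with cancellation: `s_e^*` either meets the first edge of `μ`, leaving a vertex
projection or zero, or, when `μ` is a vertex, is absorbed as `s_e^* s_ν^* = (s_ν s_e)^*`. -/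
lemma star_s_mul_mem_pathSpan (e : E) (l : List E) (x : V) (m : List E) (y : V) :
    star (G.s e) * (pathElem G l x * star (pathElem G m y)) ∈ pathSpan G := by
  cases l with
  | nil =>
    have h1 : star (G.s e) * (pathElem G [] x * star (pathElem G m y)) =
        star (pathElem G m y * G.p x * G.s e) := by
      simp [pathElem, G.isCuntzKrieger_p_s.star_p, mul_assoc]
    rw [h1, mul_assoc]
    rcases G.isCuntzKrieger_p_s.p_mul_s x e with h | h
    · simp [h]
    · rw [h]
      rcases pathElem_mul_s (G := G) m y e with h | h
      · simp [h]
      · rw [h]; exact star_pathElem_mem _ _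
  | cons f l =>
    rw [← mul_assoc, pathElem, ← mul_assoc]
    by_cases hef : e = f
    · subst hef
      rw [G.isCuntzKrieger_p_s.star_mul, mul_assoc]
      exact p_mul_mem_pathSpan _ l x m y
    · simp [G.isCuntzKrieger_p_s.star_s_mul_s_of_ne hef]

lemma mul_mem_closure_pathSpan {a : CStar G}
    (ha : ∀ l x m y, a * (pathElem G l x * star (pathElem G m y)) ∈ pathSpan G) {b : CStar G}
    (hb : b ∈ (pathSpan G).topologicalClosure) : a * b ∈ (pathSpan G).topologicalClosure := by
  refine map_mem_closure (continuous_const_mul a) hb fun b hb => ?_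
  induction hb using Submodule.span_induction with
  | mem b hb => obtain ⟨l, x, m, y, rfl⟩ := hb; exact ha l x m y
  | zero => simp
  | add b c _ _ hb hc =>
    rw [mul_add]
    exact add_mem (S := Submodule ℂ (CStar G)) hb hc
  | smul r b _ hb =>
    rw [mul_smul_comm]
    exact Submodule.smul_mem _ _ hb

lemma mul_mem_closure_pathSpan' (a : CStar G) {b : CStar G}
    (hb : b ∈ (pathSpan G).topologicalClosure) : a * b ∈ (pathSpan G).topologicalClosure := by
  -- Requiring the condition for `star a` too makes the multipliers of the closure a closed
  -- `⋆`-subalgebra, so only generators need checking.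
  let T : NonUnitalStarSubalgebra ℂ (CStar G) :=
    { carrier := {a | ∀ b ∈ (pathSpan G).topologicalClosure,
        a * b ∈ (pathSpan G).topologicalClosure ∧ star a * b ∈ (pathSpan G).topologicalClosure}
      add_mem' := fun {a a'} ha ha' b hb => by
        rw [star_add, add_mul, add_mul]
        exact ⟨add_mem (ha b hb).1 (ha' b hb).1, add_mem (ha b hb).2 (ha' b hb).2⟩
      zero_mem' := fun b _ => by simp
      mul_mem' := fun {a a'} ha ha' b hb => by
        rw [star_mul, mul_assoc, mul_assoc]
        exact ⟨(ha _ (ha' b hb).1).1, (ha' _ (ha b hb).2).2⟩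
      smul_mem' := fun r a ha b hb => by
        rw [star_smul, smul_mul_assoc, smul_mul_assoc]
        exact ⟨Submodule.smul_mem _ _ (ha b hb).1, Submodule.smul_mem _ _ (ha b hb).2⟩
      star_mem' := fun {a} ha b hb => by
        rw [star_star]
        exact (ha b hb).symm }
  have hT : T = ⊤ := by
    refine eq_top_of_isClosed T ?_ (fun x b hb => ?_) fun e b hb => ?_
    · have : (T : Set (CStar G)) = ⋂ b ∈ (pathSpan G).topologicalClosure,
          ((fun a => a * b) ⁻¹' ((pathSpan G).topologicalClosure : Set (CStar G)) ∩
            (fun a => star a * b) ⁻¹' ((pathSpan G).topologicalClosure : Set (CStar G))) := by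
        ext a
        simp only [Set.mem_iInter, Set.mem_inter_iff, Set.mem_preimage, SetLike.mem_coe]
        rfl
      rw [this]
      refine isClosed_biInter fun b _ => IsClosed.inter ?_ ?_
      · exact (pathSpan G).isClosed_topologicalClosure.preimage (continuous_mul_const b)
      · exact (pathSpan G).isClosed_topologicalClosure.preimage
          (continuous_star.mul continuous_const)
    · rw [G.isCuntzKrieger_p_s.star_p]
      have := mul_mem_closure_pathSpan (p_mul_mem_pathSpan x) hb
      exact ⟨this, this⟩
    · exact ⟨mul_mem_closure_pathSpan (s_mul_mem_pathSpan e) hb,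
        mul_mem_closure_pathSpan (star_s_mul_mem_pathSpan e) hb⟩
  have : a ∈ T := by rw [hT]; trivial
  exact (this b hb).1

/-- The elements `s_μ s_ν^*` span a dense subspace of `C⋆(G)`. -/
theorem closure_pathSpan_eq_univ : closure (pathSpan G : Set (CStar G)) = Set.univ := by
  let T : NonUnitalStarSubalgebra ℂ (CStar G) :=
    { (pathSpan G).topologicalClosure with
      mul_mem' := fun {a b} _ hb => mul_mem_closure_pathSpan' a hb
      star_mem' := fun {a} ha =>
        map_mem_closure continuous_star ha fun b hb => star_mem_pathSpan hb }
  have hp : ∀ x, G.p x ∈ pathSpan G := fun x => by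
    have h := star_pathElem_mem (G := G) [] x
    rwa [pathElem, G.isCuntzKrieger_p_s.star_p] at h
  have hT : T = ⊤ := by
    refine eq_top_of_isClosed T (pathSpan G).isClosed_topologicalClosure
      (fun x => subset_closure (hp x)) fun e => ?_
    have h := mul_mem_closure_pathSpan' (G.s e)
      ((pathSpan G).le_topologicalClosure (hp (G.source e)))
    rwa [G.isCuntzKrieger_p_s.s_mul_p_source] at h
  refine Set.eq_univ_of_forall fun a => ?_
  have : a ∈ T := by rw [hT]; trivial
  exact this

/-- A closed subspace containing all `s_μ s_ν^*` is everything. -/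
lemma mem_of_isClosed_of_pathProducts (S : Submodule ℂ (CStar G))
    (hS : IsClosed (S : Set (CStar G)))
    (h : ∀ l x m y, pathElem G l x * star (pathElem G m y) ∈ S) (a : CStar G) : a ∈ S := by
  have h1 : pathSpan G ≤ S := Submodule.span_le.2 fun b hb => by
    obtain ⟨l, x, m, y, rfl⟩ := hb
    exact h l x m y
  have h2 : a ∈ closure (pathSpan G : Set (CStar G)) := by
    rw [closure_pathSpan_eq_univ]; trivial
  exact closure_minimal h1 hS h2

/-- A path is fixed by the projection at its range, so on the span this approximate unit acts
exactly as the identity from some finite set on. -/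
lemma eventually_sum_p_mul {a : CStar G} (ha : a ∈ pathSpan G) :
    ∀ᶠ F : Finset V in Filter.atTop, (∑ x ∈ F, G.p x) * a = a := by
  induction ha using Submodule.span_induction with
  | mem a ha =>
    obtain ⟨l, x, m, y, rfl⟩ := ha
    obtain ⟨z, hz⟩ := exists_p_mul_pathElem (G := G) l x
    filter_upwards [Filter.eventually_ge_atTop {z}] with F hF
    have hz' : (∑ x ∈ F, G.p x) * G.p z = G.p z := by
      rw [Finset.sum_mul, Finset.sum_eq_single_of_mem z (Finset.singleton_subset_iff.1 hF),
        G.isCuntzKrieger_p_s.p_mul_p]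
      exact fun y _ hy => G.isCuntzKrieger_p_s.proj_orth y z hy
    rw [← mul_assoc, ← hz, ← mul_assoc, hz']
  | zero => simp
  | add a b _ _ ha hb =>
    filter_upwards [ha, hb] with F h1 h2
    rw [mul_add, h1, h2]
  | smul r a _ ha =>
    filter_upwards [ha] with F h1
    rw [mul_smul_comm, h1]

end Dense

/-! ### Ground states vanish on edges -/

section Ground

variable {V : Type u} {E : Type v} {G : DirectedGraph V E}

lemma isEntireOrbit_s (c : E → Set.Ioi (0 : ℝ)) (e : E) :
    IsEntireOrbit (G.action c) (G.s e)
      fun ζ => Complex.exp (ζ * Real.log (c e) * Complex.I) • G.s e where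
  differentiable := by fun_prop
  eq_orbit t := by
    rw [action, gauge_s, Circle.coe_exp]
    push_cast
    rfl

lemma isEntireOrbit_star_s (c : E → Set.Ioi (0 : ℝ)) (e : E) :
    IsEntireOrbit (G.action c) (star (G.s e))
      fun ζ => Complex.exp (-(ζ * Real.log (c e) * Complex.I)) • star (G.s e) where
  differentiable := by fun_prop
  eq_orbit t := by
    rw [map_star, action, gauge_s, Circle.coe_exp, star_smul, Complex.star_def, ← Complex.exp_conj]
    simp

lemma _root_.IsGroundState.apply_s_mul_star_s {c : E → Set.Ioi (0 : ℝ)} {φ : CStar G →L[ℂ] ℂ}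
    (hφ : IsGroundState (G.action c) φ) {e : E} (hc : 1 < (c e : ℝ)) :
    φ (G.s e * star (G.s e)) = 0 := by
  obtain ⟨M, hM⟩ := hφ.bounded (G.s e) ⟨_, isEntireOrbit_s c e⟩ _ _ (isEntireOrbit_star_s c e)
  have hL : 0 < Real.log (c e) := Real.log_pos hc
  by_contra h0
  have hpos : 0 < ‖φ (G.s e * star (G.s e))‖ := norm_pos_iff.2 h0
  -- At `ζ = n i` the scalar is `exp(n log c(e)) ≥ 1 + n log c(e)`, so this `n` already exceeds the
  -- bound `M`.
  obtain ⟨n, hn⟩ := exists_nat_gt (M / ‖φ (G.s e * star (G.s e))‖ / Real.log (c e))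
  have h := hM (n * Complex.I) (by simp)
  have hexp : -((n : ℂ) * Complex.I * Real.log (c e) * Complex.I) =
      ((n * Real.log (c e) : ℝ) : ℂ) := by
    push_cast
    linear_combination (-(n : ℂ) * Real.log (c e)) * Complex.I_mul_I
  rw [hexp, mul_smul_comm, map_smul, norm_smul, Complex.norm_exp, Complex.ofReal_re] at h
  have h1 := Real.add_one_le_exp (n * Real.log (c e))
  rw [div_lt_iff₀ hL, div_lt_iff₀ hpos] at hn
  nlinarith

/-- A ground state vanishes on `s_μ s_ν^*` unless both paths are vertices. -/
lemma _root_.IsGroundState.apply_pathElem {c : E → Set.Ioi (0 : ℝ)} (hc : ∀ e, 1 < (c e : ℝ))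
    {φ : CStar G →L[ℂ] ℂ} (hφ : IsGroundState (G.action c) φ) (l : List E) (x : V) (m : List E)
    (y : V) (h : l ≠ [] ∨ m ≠ []) : φ (pathElem G l x * star (pathElem G m y)) = 0 := by
  have h0 : ∀ e, φ (star (star (G.s e)) * star (G.s e)) = 0 := fun e => by
    rw [star_star]; exact hφ.apply_s_mul_star_s (hc e)
  rcases l with - | ⟨e, l⟩
  · rcases m with - | ⟨f, m⟩
    · simp at h
    · have h1 := map_star_mul_eq_zero_right hφ.nonneg (h0 f)
        (star (pathElem G [] x * star (pathElem G m y)))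
      rwa [star_star, mul_assoc, ← star_mul] at h1
  · have h1 := map_star_mul_eq_zero_left hφ.nonneg (h0 e)
      (pathElem G l x * star (pathElem G m y))
    rwa [star_star, ← mul_assoc] at h1

lemma _root_.IsGroundState.apply_p_of_not_isSingular {c : E → Set.Ioi (0 : ℝ)}
    (hc : ∀ e, 1 < (c e : ℝ)) {φ : CStar G →L[ℂ] ℂ} (hφ : IsGroundState (G.action c) φ) {x : V}
    (hx : ¬ G.IsSingular x) : φ (G.p x) = 0 := by
  rw [IsSingular, not_or, Set.not_infinite] at hx
  obtain ⟨hne, hfin⟩ := hx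
  have h := G.isCuntzKrieger_p_s.sum_eq x hfin.toFinset
    ((Set.Finite.toFinset_nonempty _).2 (Set.nonempty_iff_ne_empty.2 hne)) (by simp)
  rw [h, map_sum]
  exact Finset.sum_eq_zero fun e _ => hφ.apply_s_mul_star_s (hc e)

end Ground

/-! ### Functionals on `C₀(V)` -/

section Vertex

variable {V : Type u} {E : Type v} {G : DirectedGraph V E}
variable [TopologicalSpace V] [DiscreteTopology V]

/-- The characteristic function of a finite set of vertices, as an element of `C₀(V)`. -/
def charFun (F : Finset V) : C₀(V, ℂ) where
  toFun := Set.indicator (F : Set V) 1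
  continuous_toFun := continuous_of_discreteTopology
  zero_at_infty' := by
    rw [Filter.cocompact_eq_cofinite]
    refine tendsto_const_nhds.congr' ?_
    filter_upwards [F.finite_toSet.compl_mem_cofinite] with x hx
    rw [Set.indicator_of_notMem hx]

lemma charFun_apply (F : Finset V) (x : V) : charFun F x = Set.indicator (F : Set V) 1 x := rfl

lemma norm_le_of_forall_apply_le {X : Type*} [TopologicalSpace X] {f : C₀(X, ℂ)} {M : ℝ} (hM : 0 ≤ M) (h : ∀ x, ‖f x‖ ≤ M) :
    ‖f‖ ≤ M := by
  rw [← ZeroAtInftyContinuousMap.norm_toBCF_eq_norm]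
  exact (BoundedContinuousFunction.norm_le hM).2 h

lemma norm_charFun_le (F : Finset V) : ‖charFun F‖ ≤ 1 := by
  classical
  refine norm_le_of_forall_apply_le zero_le_one fun x => ?_
  rw [charFun_apply, Set.indicator_apply]
  split_ifs <;> simp

lemma star_charFun_mul_self (F : Finset V) : star (charFun F) * charFun F = charFun F := by
  classical
  ext x
  simp only [ZeroAtInftyContinuousMap.mul_apply, ZeroAtInftyContinuousMap.star_apply,
    charFun_apply, Set.indicator_apply]
  split_ifs <;> simp

lemma charFun_eq_sum (F : Finset V) : charFun F = ∑ x ∈ F, charFun {x} := by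
  classical
  induction F using Finset.induction_on with
  | empty => ext x; simp [charFun_apply]
  | insert a F ha ih =>
    rw [Finset.sum_insert ha, ← ih]
    ext x
    simp only [ZeroAtInftyContinuousMap.add_apply, charFun_apply, Set.indicator_apply,
      Finset.mem_coe, Finset.mem_insert, Finset.mem_singleton]
    by_cases h : x = a
    · subst h; simp [ha]
    · simp [h]

lemma vertexCLM_charFun (F : Finset V) : G.vertexCLM (charFun F) = ∑ x ∈ F, G.p x := by
  classical
  change ∑' x, charFun F x • G.p x = _
  rw [tsum_eq_sum (s := F)]
  · refine Finset.sum_congr rfl fun x hx => ?_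
    rw [charFun_apply, Set.indicator_of_mem (Finset.mem_coe.2 hx), Pi.one_apply, one_smul]
  · intro x hx
    rw [charFun_apply, Set.indicator_of_notMem (by simpa using hx), zero_smul]

lemma vertexCLM_star_mul (f : C₀(V, ℂ)) :
    G.vertexCLM (star f * f) = star (G.vertexCLM f) * G.vertexCLM f := by
  change G.vertexHom (star f * f) = star (G.vertexHom f) * G.vertexHom f
  rw [map_mul, map_star]

lemma norm_vertexCLM_le (f : C₀(V, ℂ)) : ‖G.vertexCLM f‖ ≤ ‖f‖ :=
  NonUnitalStarAlgHom.norm_apply_le G.vertexHom f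

/-- A continuous functional on `C₀(V)`, `V` discrete, is determined by its values on points. -/
lemma clm_ext_charFun {τ ρ : C₀(V, ℂ) →L[ℂ] ℂ} (h : ∀ x, τ (charFun {x}) = ρ (charFun {x})) :
    τ = ρ := by
  classical
  rw [← sub_eq_zero]
  set δ := τ - ρ
  have hδ : ∀ x, δ (charFun {x}) = 0 := fun x => by simp [δ, h]
  ext f
  rw [_root_.zero_apply, ← norm_le_zero_iff]
  refine le_of_forall_pos_le_add fun ε hε => ?_
  -- Truncate `f` to the finite set where `‖f x‖ ≥ η`: that part is a combination of point
  -- functions, killed by `δ`, and the rest has norm at most `η`. The `+ 1` allows for `δ = 0`.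
  have hη : 0 < ε / (‖δ‖ + 1) := by positivity
  have hf := (zero_at_infty f).eventually (Metric.ball_mem_nhds 0 hη)
  rw [Filter.cocompact_eq_cofinite, Filter.eventually_cofinite] at hf
  set F := hf.toFinset
  have hsum : δ f = δ (f - charFun F * f) := by
    have h1 : charFun F * f = ∑ x ∈ F, f x • charFun {x} := by
      rw [charFun_eq_sum, Finset.sum_mul]
      refine Finset.sum_congr rfl fun x _ => ?_
      ext y
      simp only [ZeroAtInftyContinuousMap.mul_apply, ZeroAtInftyContinuousMap.smul_apply,
        charFun_apply, smul_eq_mul]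
      by_cases hy : y = x
      · subst hy; simp
      · simp [hy]
    rw [map_sub, h1, map_sum, Finset.sum_eq_zero, sub_zero]
    intro x _
    rw [map_smul, hδ, smul_zero]
  have hnorm : ‖f - charFun F * f‖ ≤ ε / (‖δ‖ + 1) := by
    refine norm_le_of_forall_apply_le hη.le fun x => ?_
    rw [ZeroAtInftyContinuousMap.sub_apply, ZeroAtInftyContinuousMap.mul_apply, charFun_apply]
    by_cases hx : x ∈ F
    · simp [hx, hη.le]
    · have : ‖f x‖ < ε / (‖δ‖ + 1) := by simpa [F] using hx
      simpa [hx] using this.le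
  rw [hsum, zero_add]
  calc ‖δ (f - charFun F * f)‖ ≤ ‖δ‖ * (ε / (‖δ‖ + 1)) :=
        (δ.le_opNorm _).trans (by gcongr)
    _ ≤ (‖δ‖ + 1) * (ε / (‖δ‖ + 1)) := by gcongr; linarith
    _ = ε := by field_simp

/-- Singletons are open, and a function living on `{x}` is a multiple of its characteristic
function. -/
lemma mem_functionalSupport_iff {τ : C₀(V, ℂ) →L[ℂ] ℂ} {x : V} :
    x ∈ functionalSupport τ ↔ τ (charFun {x}) ≠ 0 := by
  classical
  constructor
  · intro h h0
    obtain ⟨f, hf, hτ⟩ := h {x} (isOpen_discrete _) rfl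
    refine hτ ?_
    have : f = f x • charFun {x} := by
      ext y
      rw [ZeroAtInftyContinuousMap.smul_apply, charFun_apply]
      by_cases hy : y = x
      · subst hy; simp
      · have : f y = 0 := by
          by_contra hne
          exact hy (hf hne)
        simp [hy, this]
    rw [this, map_smul, h0, smul_zero]
  · intro h U _ hxU
    refine ⟨charFun {x}, fun y hy => ?_, h⟩
    have : y = x := by
      by_contra hne
      exact hy (by simp [charFun_apply, hne])
    exact this ▸ hxU

/-- The restriction to `C₀(V)` of a state of `C⋆(G)` is a state. -/
lemma isTracialState_comp_vertexCLM {φ : CStar G →L[ℂ] ℂ} (hφ : IsState φ) :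
    IsTracialState (φ.comp G.vertexCLM) where
  nonneg f := by
    rw [ContinuousLinearMap.comp_apply, vertexCLM_star_mul]
    exact hφ.nonneg _
  mul_comm f g := by rw [mul_comm]
  norm_eq_one := by
    apply le_antisymm
    · refine ContinuousLinearMap.opNorm_le_bound _ zero_le_one fun f => ?_
      calc ‖φ (G.vertexCLM f)‖ ≤ ‖φ‖ * ‖G.vertexCLM f‖ := φ.le_opNorm _
        _ ≤ 1 * ‖f‖ := by rw [hφ.norm_eq_one]; gcongr; exact norm_vertexCLM_le f
    · set C := ‖φ.comp G.vertexCLM‖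
      have hC : 0 ≤ C := norm_nonneg (φ.comp G.vertexCLM)
      -- If the projection `q = ∑ p_x` fixes `a`, then `‖φ(a)‖² ≤ φ(q) φ(a^* a) ≤ C ‖a‖²`. By
      -- density `1 = ‖φ‖ ≤ √C`, hence `C ≥ 1`.
      have key : ∀ a ∈ pathSpan G, ‖φ a‖ ≤ √C * ‖a‖ := by
        intro a ha
        obtain ⟨F, hF⟩ := (eventually_sum_p_mul ha).exists
        have hcs := norm_map_star_mul_sq_le hφ.nonneg (G.vertexCLM (charFun F)) a
        have h1 : star (G.vertexCLM (charFun F)) * a = a := by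
          rw [vertexCLM_charFun, star_sum]
          simp_rw [G.isCuntzKrieger_p_s.star_p]
          exact hF
        rw [h1, ← vertexCLM_star_mul, star_charFun_mul_self] at hcs
        have h2 : (φ (G.vertexCLM (charFun F))).re ≤ C :=
          calc (φ (G.vertexCLM (charFun F))).re ≤ ‖φ.comp G.vertexCLM (charFun F)‖ :=
                Complex.re_le_norm _
            _ ≤ C * ‖charFun F‖ := ContinuousLinearMap.le_opNorm _ _
            _ ≤ C * 1 := by gcongr; exact norm_charFun_le F
            _ = C := mul_one C
        have h3 : (φ (star a * a)).re ≤ ‖a‖ ^ 2 :=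
          calc (φ (star a * a)).re ≤ ‖φ (star a * a)‖ := Complex.re_le_norm _
            _ ≤ ‖φ‖ * ‖star a * a‖ := φ.le_opNorm _
            _ = ‖a‖ ^ 2 := by rw [hφ.norm_eq_one, one_mul, CStarRing.norm_star_mul_self, sq]
        have h4 : 0 ≤ (φ (star a * a)).re := (Complex.nonneg_iff.1 (hφ.nonneg a)).1
        refine le_of_sq_le_sq ?_ (by positivity)
        rw [mul_pow, Real.sq_sqrt hC]
        exact hcs.trans (mul_le_mul h2 h3 h4 hC)
      have h1 : ‖φ‖ ≤ √C := by
        refine ContinuousLinearMap.opNorm_le_bound _ (Real.sqrt_nonneg _) fun a => ?_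
        have ha : a ∈ closure (pathSpan G : Set (CStar G)) := by
          rw [closure_pathSpan_eq_univ]; trivial
        exact closure_minimal key (isClosed_le (f := fun a => ‖φ a‖)
          (g := fun a => √C * ‖a‖) (by fun_prop) (by fun_prop)) ha
      rw [hφ.norm_eq_one] at h1
      nlinarith [Real.sq_sqrt hC]

/-- Ground states that agree on `C₀(V)` are equal. -/
lemma _root_.IsGroundState.ext_vertexCLM {c : E → Set.Ioi (0 : ℝ)} (hc : ∀ e, 1 < (c e : ℝ))
    {φ ψ : CStar G →L[ℂ] ℂ} (hφ : IsGroundState (G.action c) φ)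
    (hψ : IsGroundState (G.action c) ψ) (h : φ.comp G.vertexCLM = ψ.comp G.vertexCLM) :
    φ = ψ := by
  have hp : ∀ x, φ (G.p x) = ψ (G.p x) := fun x => by
    have h1 := DFunLike.congr_fun h (charFun {x})
    simpa [vertexCLM_charFun] using h1
  ext a
  have h1 := mem_of_isClosed_of_pathProducts
    (LinearMap.eqLocus (φ : CStar G →ₗ[ℂ] ℂ) (ψ : CStar G →ₗ[ℂ] ℂ))
    (isClosed_eq φ.continuous ψ.continuous) ?_ a
  · exact h1
  intro l x m y
  change φ _ = ψ _
  by_cases hlm : l ≠ [] ∨ m ≠ []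
  · rw [hφ.apply_pathElem hc l x m y hlm, hψ.apply_pathElem hc l x m y hlm]
  · push Not at hlm
    obtain ⟨rfl, rfl⟩ := hlm
    simp only [pathElem, G.isCuntzKrieger_p_s.star_p]
    by_cases hxy : x = y
    · subst hxy
      rw [G.isCuntzKrieger_p_s.p_mul_p, hp]
    · rw [G.isCuntzKrieger_p_s.proj_orth x y hxy, map_zero, map_zero]

end Vertex

end DirectedGraph

end
noncomputable section

/-! ### Partial permutation operators on `ℓ²(X)` -/

section PartialPermutation

/-- The Hilbert space `ℓ²(X)`. -/
abbrev EllTwo (X : Type w) : Type w := lp (fun _ : X => ℂ) 2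

variable {X : Type w}

/-- Where defined, `f.symm` is injective, so the left side is a partial sum of `‖ξ‖²`. This gives
both square summability and contractivity of the operator below. -/
lemma sum_elim_symm_le (f : X ≃. X) (ξ : EllTwo X) (F : Finset X) :
    ∑ y ∈ F, ‖(f.symm y).elim 0 ξ‖ ^ (2 : ℝ≥0∞).toReal ≤ ‖ξ‖ ^ (2 : ℝ≥0∞).toReal := by
  classical
  have hinj : ∀ a a' b, b ∈ f.symm a → b ∈ f.symm a' → a = a' := fun a a' b h h' =>
    f.symm.inj h h'
  refine le_trans (le_of_eq ?_) (lp.sum_rpow_le_norm_rpow (by simp) ξ (F.filterMap f.symm hinj))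
  induction F using Finset.induction_on with
  | empty => simp
  | insert a F ha ih =>
    rw [Finset.sum_insert ha, ih]
    rcases h : f.symm a with - | b
    · have : (insert a F).filterMap f.symm hinj = F.filterMap f.symm hinj := by
        ext x
        simp [Finset.mem_filterMap, h]
      rw [this]
      simp
    · have h1 : (insert a F).filterMap f.symm hinj = insert b (F.filterMap f.symm hinj) := by
        ext x
        simp [Finset.mem_filterMap, h, eq_comm]
      have h2 : b ∉ F.filterMap f.symm hinj := by
        rw [Finset.mem_filterMap]
        rintro ⟨a', ha', hb⟩
        exact ha (hinj a a' b h hb ▸ ha')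
      rw [h1, Finset.sum_insert h2]
      simp

/-- The partial isometry of `ℓ²(X)` that permutes the basis vectors as the partial bijection `f`
does, and kills the basis vectors on which `f` is not defined. -/
def partialPermOp (f : X ≃. X) : EllTwo X →L[ℂ] EllTwo X :=
  LinearMap.mkContinuous
    { toFun := fun ξ => ⟨fun y => (f.symm y).elim 0 ξ, memℓp_gen' (sum_elim_symm_le f ξ)⟩
      map_add' := fun ξ η => by
        ext y
        change (f.symm y).elim 0 (fun z => ξ z + η z) =
          (f.symm y).elim 0 (fun z => ξ z) + (f.symm y).elim 0 (fun z => η z)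
        cases f.symm y <;> simp
      map_smul' := fun r ξ => by
        ext y
        change (f.symm y).elim 0 (fun z => r * ξ z) = r * (f.symm y).elim 0 (fun z => ξ z)
        cases f.symm y <;> simp }
    1 fun ξ => by
      rw [one_mul]
      exact lp.norm_le_of_forall_sum_le (by simp) (norm_nonneg ξ) (sum_elim_symm_le f ξ)

lemma partialPermOp_apply (f : X ≃. X) (ξ : EllTwo X) (y : X) :
    partialPermOp f ξ y = (f.symm y).elim 0 ξ := rfl

lemma partialPermOp_single [DecidableEq X] (f : X ≃. X) (x : X) :
    partialPermOp f (lp.single 2 x (1 : ℂ)) =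
      (f x).elim (0 : EllTwo X) fun y => lp.single 2 y (1 : ℂ) := by
  ext y
  rw [partialPermOp_apply]
  by_cases h : f x = some y
  · rw [h, f.eq_some_iff.2 h]
    simp
  · have h1 : (f.symm y).elim 0 (lp.single (E := fun _ : X => ℂ) 2 x (1 : ℂ)) = 0 := by
      rcases hy : f.symm y with - | z
      · rfl
      · have : z ≠ x := fun hz => h (f.eq_some_iff.1 (hz ▸ hy))
        simp [this]
    rw [h1]
    rcases hx : f x with - | z
    · rfl
    · have : y ≠ z := fun hz => h (hz ▸ hx)
      simp [this]

/-- The matrix has entries 0 and 1, and transposing it inverts the partial bijection; coordinates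
are read off by pairing with basis vectors. -/
lemma star_partialPermOp (f : X ≃. X) : star (partialPermOp f) = partialPermOp f.symm := by
  classical
  ext ξ x
  have h1 : ∀ η : EllTwo X, η x = inner ℂ (lp.single 2 x (1 : ℂ)) η := fun η => by
    rw [lp.inner_single_left]; simp
  rw [h1, ContinuousLinearMap.star_eq_adjoint, ContinuousLinearMap.adjoint_inner_right,
    partialPermOp_single, partialPermOp_apply, PEquiv.symm_symm]
  cases f x
  · simp
  · simp [lp.inner_single_left]

end PartialPermutation

namespace DirectedGraph

/-! ### The path space representation -/

section Path

variable {V : Type u} {E : Type v} (G : DirectedGraph V E)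

/-- The range of the path with edges `l` that starts at `x`. -/
def pathRange : List E → V → V
  | [], x => x
  | e :: _, _ => G.range e

/-- The edges `l` form a path that starts at the vertex `x`, and `x` is singular. -/
def IsSingularPath : List E → V → Prop
  | [], x => G.IsSingular x
  | e :: l, x => G.source e = G.pathRange l x ∧ IsSingularPath l x

open Classical in
/-- The partial bijection fixing the paths with range `x`. -/
def vertexPEquiv (x : V) : List E × V ≃. List E × V where
  toFun a := if G.IsSingularPath a.1 a.2 ∧ G.pathRange a.1 a.2 = x then some a else none
  invFun a := if G.IsSingularPath a.1 a.2 ∧ G.pathRange a.1 a.2 = x then some a else none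
  inv := by
    intro a b
    simp only [Option.ite_none_right_eq_some, Option.some.injEq]
    constructor <;> (rintro ⟨h, rfl⟩; exact ⟨h, rfl⟩)

open Classical in
/-- The partial bijection `μ ↦ eμ` of the set of paths. -/
def edgePEquiv (e : E) : List E × V ≃. List E × V where
  toFun a := if G.IsSingularPath (e :: a.1) a.2 then some (e :: a.1, a.2) else none
  invFun
    | ([], _) => none
    | (f :: l, x) => if f = e ∧ G.IsSingularPath (f :: l) x then some (l, x) else none
  inv := by
    rintro ⟨l, x⟩ ⟨- | ⟨f, m⟩, y⟩
    · simp
    · simp only [Option.ite_none_right_eq_some, Option.some.injEq, Prod.mk.injEq,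
        List.cons.injEq]
      constructor
      · rintro ⟨⟨rfl, h⟩, rfl, rfl⟩
        exact ⟨h, ⟨rfl, rfl⟩, rfl⟩
      · rintro ⟨h, ⟨rfl, rfl⟩, rfl⟩
        exact ⟨⟨rfl, h⟩, rfl, rfl⟩

/-- The projection onto the span of the paths with range `x`. -/
def pathP (x : V) : EllTwo (List E × V) →L[ℂ] EllTwo (List E × V) :=
  partialPermOp (G.vertexPEquiv x)

/-- The creation operator of the edge `e`. -/
def pathS (e : E) : EllTwo (List E × V) →L[ℂ] EllTwo (List E × V) :=
  partialPermOp (G.edgePEquiv e)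

variable {G}

open Classical in
lemma pathP_apply (x : V) (ξ : EllTwo (List E × V)) (a : List E × V) :
    G.pathP x ξ a = if G.IsSingularPath a.1 a.2 ∧ G.pathRange a.1 a.2 = x then ξ a else 0 := by
  change (if G.IsSingularPath a.1 a.2 ∧ G.pathRange a.1 a.2 = x then some a else none).elim 0 ξ = _
  split_ifs <;> rfl

open Classical in
lemma pathS_apply_cons (e : E) (ξ : EllTwo (List E × V)) (f : E) (l : List E) (x : V) :
    G.pathS e ξ (f :: l, x) = if f = e ∧ G.IsSingularPath (f :: l) x then ξ (l, x) else 0 := by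
  change (if f = e ∧ G.IsSingularPath (f :: l) x then some (l, x) else none).elim 0 ξ = _
  split_ifs <;> rfl

open Classical in
lemma star_pathS_apply (e : E) (ξ : EllTwo (List E × V)) (a : List E × V) :
    star (G.pathS e) ξ a =
      if G.IsSingularPath (e :: a.1) a.2 then ξ (e :: a.1, a.2) else 0 := by
  rw [pathS, star_partialPermOp]
  change (if G.IsSingularPath (e :: a.1) a.2 then some (e :: a.1, a.2) else none).elim 0 ξ = _
  split_ifs <;> rfl

lemma pathS_mul_star_apply_nil (e : E) (ξ : EllTwo (List E × V)) (x : V) :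
    (G.pathS e * star (G.pathS e)) ξ ([], x) = 0 := rfl

open Classical in
lemma pathS_mul_star_apply_cons (e : E) (ξ : EllTwo (List E × V)) (f : E) (l : List E) (x : V) :
    (G.pathS e * star (G.pathS e)) ξ (f :: l, x) =
      if f = e ∧ G.IsSingularPath (f :: l) x then ξ (f :: l, x) else 0 := by
  rw [mul_apply_eq_comp, pathS_apply_cons]
  split_ifs with h
  · obtain ⟨rfl, h⟩ := h
    rw [star_pathS_apply, if_pos h]
  · rfl

variable (G) in
/-- The path space operators satisfy the relations of the graph algebra. -/
theorem isCuntzKrieger_path : G.IsCuntzKrieger G.pathP G.pathS where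
  proj x := by
    classical
    rw [isStarProjection_iff']
    constructor
    · ext ξ a
      simp only [mul_apply_eq_comp, pathP_apply]
      split_ifs <;> rfl
    · rw [pathP, star_partialPermOp]; rfl
  proj_orth x y hxy := by
    classical
    ext ξ a
    simp only [mul_apply_eq_comp, pathP_apply]
    split_ifs with h1 h2
    · exact absurd (h1.2.symm.trans h2.2) hxy
    · rfl
    · rfl
  partial_isometry e := by
    classical
    ext ξ ⟨l, x⟩
    rw [mul_apply_eq_comp]
    cases l with
    | nil => rfl
    | cons f l =>
      rw [pathS_mul_star_apply_cons, pathS_apply_cons]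
      split_ifs <;> rfl
  range_orth e f hef := by
    classical
    ext ξ ⟨l, x⟩
    rw [mul_apply_eq_comp]
    cases l with
    | nil => rfl
    | cons g l =>
      rw [pathS_mul_star_apply_cons, pathS_mul_star_apply_cons]
      split_ifs with h1 h2
      · exact absurd (h1.1.symm.trans h2.1) hef
      · rfl
      · rfl
  star_mul e := by
    classical
    ext ξ a
    rw [mul_apply_eq_comp, star_pathS_apply, pathS_apply_cons, pathP_apply]
    simp only [IsSingularPath, true_and]
    by_cases h1 : G.source e = G.pathRange a.1 a.2 <;>
      by_cases h2 : G.IsSingularPath a.1 a.2 <;> simp [h1, h2]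
    exact fun h => absurd h.symm h1
  le_range e := by
    classical
    ext ξ ⟨l, x⟩
    rw [mul_apply_eq_comp, pathP_apply]
    cases l with
    | nil => rw [pathS_mul_star_apply_nil, ite_self]
    | cons f l =>
      rw [pathS_mul_star_apply_cons]
      simp only [pathRange]
      split_ifs with h1 h2 h3
      · rfl
      · rfl
      · exact absurd ⟨h3.2, by rw [h3.1]⟩ h1
      · rfl
  sum_eq x F hF hx := by
    classical
    ext ξ ⟨l, y⟩
    rw [_root_.sum_apply, lp.coeFn_sum, Finset.sum_apply, pathP_apply]
    cases l with
    | nil =>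
      simp only [pathS_mul_star_apply_nil, Finset.sum_const_zero]
      -- A path of length zero at `y` lies in the range of `p_y` but of no `s_e s_e^*`. The sum
      -- relation survives because only singular `y` carry such a path.
      refine if_neg ?_
      rintro ⟨h1, rfl⟩
      have h2 : G.range ⁻¹' {y} = F := by ext e; simp [hx, pathRange]
      rcases h1 with h1 | h1
      · rw [h2, Finset.coe_eq_empty] at h1
        exact hF.ne_empty h1
      · rw [h2] at h1
        exact h1 F.finite_toSet
    | cons f l =>
      simp only [pathS_mul_star_apply_cons, pathRange, ite_and, Finset.sum_ite_eq, hx]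
      by_cases h1 : G.range f = x <;> by_cases h2 : G.IsSingularPath (f :: l) y <;> simp [h1, h2]

variable (G) in
/-- The path space representation. -/
def pathRealisation : Realisation G where
  carrier := EllTwo (List E × V) →L[ℂ] EllTwo (List E × V)
  p := G.pathP
  s := G.pathS
  isCuntzKrieger := G.isCuntzKrieger_path

variable (G) in
/-- The path space representation as a homomorphism. -/
def pathRep : CStar G →⋆ₙₐ[ℂ] (EllTwo (List E × V) →L[ℂ] EllTwo (List E × V)) :=
  G.lift G.pathRealisation

lemma pathRep_p (x : V) : G.pathRep (G.p x) = G.pathP x := rfl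

lemma pathRep_s (e : E) : G.pathRep (G.s e) = G.pathS e := rfl

variable (G) in
/-- The functional that sends `b` to the coordinate of `b ξ` at `a`. -/
def pathCoord (ξ : EllTwo (List E × V)) (a : List E × V) : CStar G →L[ℂ] ℂ where
  toFun b := G.pathRep b ξ a
  map_add' b b' := by rw [map_add]; rfl
  map_smul' r b := by rw [map_smul]; rfl
  cont := (lp.evalCLM ℂ (fun _ : List E × V => ℂ) 2 a).continuous.comp
    ((ContinuousLinearMap.apply ℂ _ ξ).continuous.comp (continuous_hom G.pathRep))

/-! ### Vectors supported on paths of length zero -/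

/-- A vector of the path space supported on the paths of length zero. -/
def IsVertexVector (ξ : EllTwo (List E × V)) : Prop := ∀ e l x, ξ (e :: l, x) = 0

/-- The operator `s_e^*` strips a first edge `e`, and no path in the support of `ξ` has an edge. -/
lemma IsVertexVector.star_pathElem {ξ : EllTwo (List E × V)} (hξ : IsVertexVector ξ) (l : List E)
    (hl : l ≠ []) (x : V) : G.pathRep (star (pathElem G l x)) ξ = 0 := by
  classical
  obtain ⟨e, l, rfl⟩ := List.exists_cons_of_ne_nil hl
  have h : star (G.pathS e) ξ = 0 := by
    ext a
    rw [star_pathS_apply, hξ]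
    simp
  rw [pathElem, star_mul, map_mul, map_star G.pathRep (G.s e), pathRep_s,
    mul_apply_eq_comp, h, map_zero]

/-- Creation along `l` turns a path of length zero into one with edge list `l`, or kills it. -/
lemma IsVertexVector.pathElem_apply {ξ : EllTwo (List E × V)} (hξ : IsVertexVector ξ) (l : List E)
    (x : V) (m : List E) (y : V) (hml : m ≠ l) : G.pathRep (pathElem G l x) ξ (m, y) = 0 := by
  classical
  induction l generalizing m with
  | nil =>
    obtain ⟨e, m, rfl⟩ := List.exists_cons_of_ne_nil hml
    rw [pathElem, pathRep_p, pathP_apply, hξ]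
    simp
  | cons e l ih =>
    rw [pathElem, map_mul, pathRep_s, mul_apply_eq_comp]
    cases m with
    | nil => rfl
    | cons f m =>
      rw [pathS_apply_cons]
      split_ifs with h
      · exact ih m fun hm => hml (by rw [h.1, hm])
      · rfl

lemma IsVertexVector.pathP {ξ : EllTwo (List E × V)} (hξ : IsVertexVector ξ) (x : V) :
    IsVertexVector (G.pathP x ξ) := by
  classical
  intro e l y
  rw [pathP_apply, hξ, ite_self]

/-- The total weight of a path. -/
def pathWeight (c : E → Set.Ioi (0 : ℝ)) (l : List E) : ℝ :=
  (l.map fun e => Real.log (c e)).sum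

lemma pathWeight_nonneg {c : E → Set.Ioi (0 : ℝ)} (hc : ∀ e, 1 < (c e : ℝ)) (l : List E) :
    0 ≤ pathWeight c l :=
  List.sum_nonneg fun x hx => by
    obtain ⟨e, _, rfl⟩ := List.mem_map.1 hx
    exact (Real.log_pos (hc e)).le

lemma action_pathElem (c : E → Set.Ioi (0 : ℝ)) (t : ℝ) (l : List E) (x : V) :
    G.action c t (pathElem G l x) =
      Complex.exp (t * pathWeight c l * Complex.I) • pathElem G l x := by
  induction l with
  | nil => simp [pathElem, pathWeight, action_p]
  | cons e l ih =>
    rw [pathElem, map_mul, ih, action, gauge_s, Circle.coe_exp, smul_mul_smul_comm,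
      ← Complex.exp_add]
    congr 2
    simp only [pathWeight, List.map_cons, List.sum_cons]
    push_cast
    ring

/-- The action multiplies the coordinates of `b ξ` by characters. -/
lemma IsVertexVector.action_apply (c : E → Set.Ioi (0 : ℝ)) {ξ : EllTwo (List E × V)}
    (hξ : IsVertexVector ξ) (t : ℝ) (b : CStar G) (a : List E × V) :
    G.pathRep (G.action c t b) ξ a =
      Complex.exp (t * pathWeight c a.1 * Complex.I) * G.pathRep b ξ a := by
  let ev := G.pathCoord ξ a
  let S : Submodule ℂ (CStar G) :=
    { carrier := {b | ev (G.action c t b) =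
        Complex.exp (t * pathWeight c a.1 * Complex.I) * ev b}
      add_mem' := fun {b b'} hb hb' => by
        simp only [Set.mem_ofPred_eq, map_add, mul_add] at *
        rw [hb, hb']
      zero_mem' := by simp
      smul_mem' := fun r b hb => by
        simp only [Set.mem_ofPred_eq, map_smul, smul_eq_mul] at *
        rw [hb]
        ring }
  refine mem_of_isClosed_of_pathProducts S ?_ ?_ b
  · exact isClosed_eq (ev.continuous.comp (continuous_hom _))
      (continuous_const.mul ev.continuous)
  intro l x m y
  change G.pathRep _ ξ a = _ * G.pathRep _ ξ a
  -- If `ν` has an edge, both sides vanish. Otherwise `s_μ s_ν^* ξ` lives on paths with edge list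
  -- `μ`, where the scalar from the action is the one attached to the coordinate.
  by_cases hm : m = []
  · subst hm
    have h1 : IsVertexVector (G.pathRep (star (pathElem G [] y)) ξ) := by
      rw [pathElem, G.isCuntzKrieger_p_s.star_p, pathRep_p]
      exact hξ.pathP y
    have h2 : G.action c t (star (pathElem G [] y)) = star (pathElem G [] y) := by
      rw [pathElem, map_star, action_p]
    rw [map_mul (G.action c t), h2, action_pathElem, map_mul, map_smul, map_mul,
      mul_apply_eq_comp, mul_apply_eq_comp]
    change _ * G.pathRep (pathElem G l x) _ a = _
    by_cases ha : a.1 = l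
    · rw [ha]
    · rw [h1.pathElem_apply l x a.1 a.2 ha, mul_zero, mul_zero]
  · have h1 : G.pathRep (G.action c t (star (pathElem G m y))) ξ = 0 := by
      rw [map_star, action_pathElem, star_smul, map_smul, _root_.smul_apply,
        hξ.star_pathElem m hm, smul_zero]
    rw [map_mul, map_mul, map_mul, mul_apply_eq_comp, mul_apply_eq_comp,
      h1, hξ.star_pathElem m hm, map_zero, map_zero]
    simp

end Path

end DirectedGraph

/-- Entire functions that agree on the real line are equal. -/
lemma eq_of_differentiable_of_eq_ofReal {f g : ℂ → ℂ} (hf : Differentiable ℂ f)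
    (hg : Differentiable ℂ g) (h : ∀ t : ℝ, f t = g t) : f = g := by
  -- Real points accumulate at 0, so the identity theorem applies there.
  have h1 : Filter.Tendsto (fun t : ℝ => (t : ℂ)) (nhdsWithin 0 {0}ᶜ) (nhdsWithin 0 {0}ᶜ) := by
    refine tendsto_nhdsWithin_iff.2 ⟨?_, ?_⟩
    · exact (Complex.continuous_ofReal.tendsto' 0 0 Complex.ofReal_zero).mono_left
        nhdsWithin_le_nhds
    · filter_upwards [self_mem_nhdsWithin] with t ht
      simpa using ht
  refine AnalyticOnNhd.eq_of_frequently_eq (z₀ := 0)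
    (fun z _ => hf.analyticAt z) (fun z _ => hg.analyticAt z) ?_
  exact h1.frequently (Filter.Frequently.of_forall h)

namespace DirectedGraph

/-! ### Vector functionals of the path space -/

section VectorState

variable {V : Type u} {E : Type v} {G : DirectedGraph V E}

variable (G) in
/-- The vector functional `a ↦ ⟪ξ, a ξ⟫` of the path space representation. -/
def vectorFunctional (ξ : EllTwo (List E × V)) : CStar G →L[ℂ] ℂ where
  toFun a := inner ℂ ξ (G.pathRep a ξ)
  map_add' a b := by rw [map_add, _root_.add_apply, inner_add_right]
  map_smul' r a := by rw [map_smul, _root_.smul_apply, inner_smul_right]; rfl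
  cont := (innerSL ℂ ξ).continuous.comp
    ((ContinuousLinearMap.apply ℂ _ ξ).continuous.comp (continuous_hom G.pathRep))

lemma vectorFunctional_apply (ξ : EllTwo (List E × V)) (a : CStar G) :
    G.vectorFunctional ξ a = inner ℂ ξ (G.pathRep a ξ) := rfl

lemma vectorFunctional_nonneg (ξ : EllTwo (List E × V)) (a : CStar G) :
    0 ≤ G.vectorFunctional ξ (star a * a) := by
  rw [vectorFunctional_apply, map_mul, map_star, mul_apply_eq_comp,
    ContinuousLinearMap.star_eq_adjoint, ContinuousLinearMap.adjoint_inner_right,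
    inner_self_eq_norm_sq_to_K]
  norm_cast
  exact Complex.zero_le_real.2 (sq_nonneg _)

lemma norm_pathRep_apply_le (a : CStar G) (ξ : EllTwo (List E × V)) :
    ‖G.pathRep a ξ‖ ≤ ‖a‖ * ‖ξ‖ :=
  ((G.pathRep a).le_opNorm ξ).trans
    (mul_le_mul_of_nonneg_right (NonUnitalStarAlgHom.norm_apply_le _ a) (norm_nonneg ξ))

lemma norm_vectorFunctional_apply_le (ξ : EllTwo (List E × V)) (a : CStar G) :
    ‖G.vectorFunctional ξ a‖ ≤ ‖ξ‖ * ‖G.pathRep a ξ‖ :=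
  norm_inner_le_norm (𝕜 := ℂ) ξ (G.pathRep a ξ)

/-- Coordinatewise, the orbit is a scalar entire function known on the real line, so the identity
theorem fixes it for any entire extension `f`. -/
lemma IsVertexVector.entireOrbit_apply {c : E → Set.Ioi (0 : ℝ)} {ξ : EllTwo (List E × V)}
    (hξ : IsVertexVector ξ) {b : CStar G} {f : ℂ → CStar G}
    (hf : IsEntireOrbit (G.action c) b f) (ζ : ℂ) (a : List E × V) :
    G.pathRep (f ζ) ξ a = Complex.exp (ζ * pathWeight c a.1 * Complex.I) * G.pathRep b ξ a := by
  let ev := G.pathCoord ξ a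
  refine congr_fun (eq_of_differentiable_of_eq_ofReal (f := fun ζ => ev (f ζ))
    (g := fun ζ => Complex.exp (ζ * pathWeight c a.1 * Complex.I) * ev b) ?_ ?_ fun t => ?_) ζ
  · exact ev.differentiable.comp hf.differentiable
  · fun_prop
  · simp only [hf.eq_orbit]
    exact hξ.action_apply c t b a

/-- Each coordinate is scaled by modulus `exp(-w Im ζ) ≤ 1`, since path weights `w` are nonnegative.
-/
lemma IsVertexVector.norm_entireOrbit_le {c : E → Set.Ioi (0 : ℝ)} (hc : ∀ e, 1 < (c e : ℝ))
    {ξ : EllTwo (List E × V)} (hξ : IsVertexVector ξ) {b : CStar G} {f : ℂ → CStar G}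
    (hf : IsEntireOrbit (G.action c) b f) {ζ : ℂ} (hζ : 0 ≤ ζ.im) :
    ‖G.pathRep (f ζ) ξ‖ ≤ ‖G.pathRep b ξ‖ := by
  refine lp.norm_mono two_ne_zero fun a => ?_
  rw [hξ.entireOrbit_apply hf, norm_mul]
  refine mul_le_of_le_one_left (norm_nonneg _) ?_
  rw [Complex.norm_exp, Real.exp_le_one_iff]
  simpa using mul_nonneg hζ (pathWeight_nonneg hc a.1)

/-- A vertex vector defines a functional that is bounded on the upper half plane. -/
lemma IsVertexVector.isGroundState {c : E → Set.Ioi (0 : ℝ)} (hc : ∀ e, 1 < (c e : ℝ))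
    {ξ : EllTwo (List E × V)} (hξ : IsVertexVector ξ) (h : ‖G.vectorFunctional ξ‖ = 1) :
    IsGroundState (G.action c) (G.vectorFunctional ξ) where
  nonneg := vectorFunctional_nonneg ξ
  norm_eq_one := h
  bounded a _ b f hf := by
    refine ⟨‖ξ‖ * (‖G.pathRep a‖ * ‖G.pathRep b ξ‖), fun ζ hζ => ?_⟩
    refine (norm_vectorFunctional_apply_le ξ _).trans ?_
    gcongr
    rw [map_mul, mul_apply_eq_comp]
    refine ((G.pathRep a).le_opNorm _).trans ?_
    gcongr
    exact hξ.norm_entireOrbit_le hc hf hζ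

/-- At a nonsingular `x`, `p_x` kills the basis vector of the path of length zero, so the formula
then needs that coordinate of `ξ` to vanish. -/
lemma IsVertexVector.vectorFunctional_p {ξ : EllTwo (List E × V)} (hξ : IsVertexVector ξ) {x : V}
    (hx : G.IsSingular x ∨ ξ ([], x) = 0) :
    G.vectorFunctional ξ (G.p x) = ((‖ξ ([], x)‖ ^ 2 : ℝ) : ℂ) := by
  classical
  have h : G.pathRep (G.p x) ξ = lp.single 2 (([] : List E), x) (ξ ([], x)) := by
    ext ⟨l, y⟩
    rw [pathRep_p, pathP_apply]
    cases l with
    | nil =>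
      change (if G.IsSingular y ∧ y = x then ξ ([], y) else 0) = _
      by_cases hxy : y = x
      · subst hxy
        rcases hx with hx | hx
        · simp [hx]
        · simp [hx]
      · rw [if_neg fun h => hxy h.2, lp.single_apply_ne]
        simpa using hxy
    | cons e l =>
      rw [hξ, ite_self, lp.single_apply_ne]
      simp
  rw [vectorFunctional_apply, h, lp.inner_single_right, inner_self_eq_norm_sq_to_K]
  norm_cast

end VectorState

/-! ### Existence of ground states -/

section Existence

variable {V : Type u} {E : Type v} {G : DirectedGraph V E}
variable [TopologicalSpace V] [DiscreteTopology V]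

lemma charFun_nonneg {τ : C₀(V, ℂ) →L[ℂ] ℂ} (hτ : IsState τ) (F : Finset V) :
    0 ≤ τ (charFun F) := by
  rw [← star_charFun_mul_self]
  exact hτ.nonneg _

lemma sum_charFun_re_le {τ : C₀(V, ℂ) →L[ℂ] ℂ} (hτ : IsState τ) (F : Finset V) :
    ∑ x ∈ F, (τ (charFun {x})).re ≤ 1 := by
  rw [← Complex.re_sum, ← map_sum, ← charFun_eq_sum]
  calc (τ (charFun F)).re ≤ ‖τ (charFun F)‖ := Complex.re_le_norm _
    _ ≤ ‖τ‖ * ‖charFun F‖ := τ.le_opNorm _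
    _ ≤ 1 * 1 := by rw [hτ.norm_eq_one]; gcongr; exact norm_charFun_le F
    _ = 1 := one_mul 1

/-- The coordinates `√τ({x})` at the paths of length zero. -/
def stateCoord (τ : C₀(V, ℂ) →L[ℂ] ℂ) : List E × V → ℂ
  | ([], x) => (√(τ (charFun {x})).re : ℝ)
  | (_ :: _, _) => 0

/-- The squared coordinates are the point masses of `τ`, whose finite sums are at most `‖τ‖ = 1`. -/
lemma sum_norm_stateCoord_le {τ : C₀(V, ℂ) →L[ℂ] ℂ} (hτ : IsState τ)
    (F : Finset (List E × V)) :
    ∑ a ∈ F, ‖stateCoord τ a‖ ^ (2 : ℝ≥0∞).toReal ≤ (1 : ℝ) ^ (2 : ℝ≥0∞).toReal := by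
  classical
  have h0 : ∀ x, 0 ≤ (τ (charFun {x})).re := fun x =>
    (Complex.nonneg_iff.1 (charFun_nonneg hτ {x})).1
  have h1 : ∀ a : List E × V, ‖stateCoord τ a‖ ^ (2 : ℝ≥0∞).toReal =
      if a.1 = [] then (τ (charFun {a.2})).re else 0 := by
    rintro ⟨- | ⟨e, l⟩, x⟩
    · simp [stateCoord, Real.sq_sqrt (h0 x)]
    · simp [stateCoord]
  rw [Real.one_rpow]
  simp_rw [h1]
  rw [← Finset.sum_filter]
  refine le_trans (le_of_eq ?_) (sum_charFun_re_le hτ ((F.filter fun a => a.1 = []).image Prod.snd))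
  rw [Finset.sum_image]
  rintro ⟨l, x⟩ ha ⟨m, y⟩ hb hxy
  simp only [Finset.coe_filter, Set.mem_ofPred_eq] at ha hb hxy
  rw [ha.2, hb.2, hxy]

/-- The vector of the path space with coordinates `√τ({x})` at the paths of length zero. -/
def stateVector {τ : C₀(V, ℂ) →L[ℂ] ℂ} (hτ : IsState τ) : EllTwo (List E × V) :=
  ⟨stateCoord τ, memℓp_gen' (sum_norm_stateCoord_le hτ)⟩

lemma isVertexVector_stateVector {τ : C₀(V, ℂ) →L[ℂ] ℂ} (hτ : IsState τ) :
    IsVertexVector (stateVector (E := E) hτ) := fun _ _ _ => rfl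

lemma norm_stateVector_le {τ : C₀(V, ℂ) →L[ℂ] ℂ} (hτ : IsState τ) :
    ‖stateVector (E := E) hτ‖ ≤ 1 :=
  lp.norm_le_of_forall_sum_le (by simp) zero_le_one (sum_norm_stateCoord_le hτ)

/-- It suffices to compare point masses. The support condition enters at nonsingular `x`, where it
forces the coordinate of the vector to be zero. -/
lemma vectorFunctional_comp_vertexCLM {τ : C₀(V, ℂ) →L[ℂ] ℂ} (hτ : IsState τ)
    (hsupp : functionalSupport τ ⊆ {x | G.IsSingular x}) :
    (G.vectorFunctional (stateVector hτ)).comp G.vertexCLM = τ := by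
  refine clm_ext_charFun fun x => ?_
  have hcoord : stateVector (E := E) hτ ([], x) = (√(τ (charFun {x})).re : ℝ) := rfl
  have hx : G.IsSingular x ∨ stateVector (E := E) hτ ([], x) = 0 := by
    by_cases h : τ (charFun {x}) = 0
    · right
      rw [hcoord, h]
      simp
    · exact Or.inl (hsupp (mem_functionalSupport_iff.2 h))
  obtain ⟨h0, h1⟩ := Complex.nonneg_iff.1 (charFun_nonneg hτ {x})
  rw [ContinuousLinearMap.comp_apply, vertexCLM_charFun, Finset.sum_singleton,
    (isVertexVector_stateVector hτ).vectorFunctional_p hx, hcoord, Complex.norm_real,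
    Real.norm_eq_abs, sq_abs, Real.sq_sqrt h0]
  exact Complex.ext rfl h1

/-- The lower bound is inherited from the restriction `τ`, of norm one, as `vertexCLM` is
contractive; `‖ξ‖ = 1` need not be computed. -/
lemma norm_vectorFunctional_stateVector {τ : C₀(V, ℂ) →L[ℂ] ℂ} (hτ : IsState τ)
    (hsupp : functionalSupport τ ⊆ {x | G.IsSingular x}) :
    ‖G.vectorFunctional (stateVector hτ)‖ = 1 := by
  have hv := norm_stateVector_le (E := E) hτ
  apply le_antisymm
  · refine ContinuousLinearMap.opNorm_le_bound _ zero_le_one fun a => ?_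
    calc ‖G.vectorFunctional (stateVector hτ) a‖
        ≤ ‖stateVector (E := E) hτ‖ * ‖G.pathRep a (stateVector hτ)‖ :=
          norm_vectorFunctional_apply_le _ a
      _ ≤ ‖stateVector (E := E) hτ‖ * (‖a‖ * ‖stateVector (E := E) hτ‖) := by
          gcongr; exact norm_pathRep_apply_le a _
      _ ≤ 1 * (‖a‖ * 1) := by gcongr
      _ = 1 * ‖a‖ := by ring
  · rw [← hτ.norm_eq_one]
    conv_lhs => rw [← vectorFunctional_comp_vertexCLM hτ hsupp]
    refine ContinuousLinearMap.opNorm_le_bound _ (norm_nonneg _) fun f => ?_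
    exact ((G.vectorFunctional (stateVector hτ)).le_opNorm (G.vertexCLM f)).trans
      (mul_le_mul_of_nonneg_left (norm_vertexCLM_le f) (norm_nonneg _))

end Existence

end DirectedGraph

end

/-- Restriction to `C₀(V)` is a bijection from the `σ`-ground states on `C⋆(G)` onto the tracial
states on `C₀(V)` supported on the singular vertices, provided that `c(e) > 1` for every edge. -/
theorem mainTheorem3 {V : Type u} {E : Type v} [TopologicalSpace V] [DiscreteTopology V]
    (G : DirectedGraph V E) (c : E → Set.Ioi (0 : ℝ)) (hc : ∀ e, 1 < (c e : ℝ)) :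
    Set.BijOn (fun φ : G.CStar →L[ℂ] ℂ => φ.comp G.vertexCLM)
      {φ | IsGroundState (G.action c) φ}
      {τ : C₀(V, ℂ) →L[ℂ] ℂ | IsTracialState τ ∧ functionalSupport τ ⊆ {x | G.IsSingular x}} := by
  refine ⟨fun φ hφ => ⟨DirectedGraph.isTracialState_comp_vertexCLM hφ.toIsState, fun x hx => ?_⟩,
    fun φ hφ ψ hψ h => hφ.ext_vertexCLM hc hψ h, fun τ hτ => ?_⟩
  · by_contra hsing
    refine DirectedGraph.mem_functionalSupport_iff.1 hx ?_
    rw [ContinuousLinearMap.comp_apply, DirectedGraph.vertexCLM_charFun, Finset.sum_singleton]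
    exact hφ.apply_p_of_not_isSingular hc hsing
  · have hs := hτ.1.toIsState
    exact ⟨G.vectorFunctional (DirectedGraph.stateVector hs),
      (DirectedGraph.isVertexVector_stateVector hs).isGroundState hc
        (DirectedGraph.norm_vectorFunctional_stateVector hs hτ.2),
      DirectedGraph.vectorFunctional_comp_vertexCLM hs hτ.2⟩
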